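/- For an integer $l\ge 1$ and $k=(k_1,\dots,k_l)\in\mathbb Z^l$ put $$\kappa(k_1,\dots,k_l)=k_1^2+k_2^2+\cdots+k_l^2-k_1k_2-k_2k_3-\cdots-k_{l-1}k_l ,$$ and let $\varphi(q)=\prod_{j\ge 1}(1-q^j)$ be Euler's product. Let $m$ be a positive integer, and for $k\in\mathbb Z^{4m-1}$ put $$\widetilde{lin}(k)=-3k_1-\cdots-3k_{m-1}+(3m-2)k_m-k_{m+1}-\cdots-k_{4m-2}+(3m-1)k_{4m-1}.$$ Then $3m\,\kappa(k)+\widetilde{lin}(k)\ge 0$ for all $k\in\mathbb Z^{4m-1}$, and $$\sum_{k\in\mathbb Z^{4m-1}} q^{\,3m\,\kappa(k)+\widetilde{lin}(k)}=\frac{\varphi(q^{3m})^{4m}\,\varphi(q^2)^2}{\varphi(q)^2\,\varphi(q^3)},$$ both as an identity in $\mathbb C[[q]]$ (with coefficientwise convergence) and, with absolute convergence of the series, for every complex number $q$ with $|q|<1$. Moreover, for $m=1$ this identity coincides, exponent by exponent and product side by product side, with the case $m=1$ of the identity $$\sum_{k\in\mathbb Z^{4m-1}} q^{\,(4m-1)\kappa(k)+lin(k)}=\frac{\varphi(q^{4m-1})^{4m-1}\,\varphi(q^{2m})^2}{\varphi(q)\,\varphi(q^m)},$$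 where $lin(k)=(2m-1)k_1-k_2-\cdots-k_{3m-1}+(4m-2)k_{3m}-k_{3m+1}-\cdots-k_{4m-1}$. -/

import Mathlib

open scoped PowerSeries PowerSeries.WithPiTopology

noncomputable section

namespace GaussSeries

/-- Euler's product `φ(q) = ∏_{j ≥ 1} (1 - q ^ j)`, in any commutative topological ring. It is used
for complex numbers `q` with `‖q‖ < 1` and for positive powers of the variable of `ℂ⟦X⟧`
(with coefficientwise convergence). -/
def eulerPhi {R : Type*} [CommRing R] [TopologicalSpace R] (q : R) : R :=
  ∏' j : ℕ, (1 - q ^ (j + 1))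

/-- `κ(k_1, …, k_l) = k_1² + ⋯ + k_l² - k_1 k_2 - ⋯ - k_{l-1} k_l`; the variable `k_j` is the value
of `k` at the (zero-based) index `j - 1`. -/
def kappa {l : ℕ} (k : Fin l → ℤ) : ℤ :=
  ∑ i : Fin l, k i ^ 2 -
    ∑ i : Fin (l - 1), k ⟨(i : ℕ), by omega⟩ * k ⟨(i : ℕ) + 1, by omega⟩

/-- The coefficient of `k_j` (with `1 ≤ j ≤ 4m - 1`) in the linear form of the class
`GAUSS(n = 1 + (4m - 1), Λ_{3m})`. -/
def linCoeff (m j : ℕ) : ℤ :=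
  if j = 1 then 2 * (m : ℤ) - 1 else if j = 3 * m then 4 * (m : ℤ) - 2 else -1

/-- `lin(k) = (2m-1) k_1 - k_2 - ⋯ - k_{3m-1} + (4m-2) k_{3m} - k_{3m+1} - ⋯ - k_{4m-1}`. -/
def lin (m : ℕ) (k : Fin (4 * m - 1) → ℤ) : ℤ :=
  ∑ i : Fin (4 * m - 1), linCoeff m ((i : ℕ) + 1) * k i

/-- The coefficient of `k_j` (with `1 ≤ j ≤ 4m - 1`) in the linear form of the class
`GAUSS(n = m + 3m, Λ_{4m-1})`. -/
def linTildeCoeff (m j : ℕ) : ℤ :=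
  if j < m then -3
  else if j = m then 3 * (m : ℤ) - 2
  else if j < 4 * m - 1 then -1
  else 3 * (m : ℤ) - 1

/-- `lin~(k) = -3 k_1 - ⋯ - 3 k_{m-1} + (3m-2) k_m - k_{m+1} - ⋯ - k_{4m-2} + (3m-1) k_{4m-1}`. -/
def linTilde (m : ℕ) (k : Fin (4 * m - 1) → ℤ) : ℤ :=
  ∑ i : Fin (4 * m - 1), linTildeCoeff m ((i : ℕ) + 1) * k i

/-- The exponent of `q` in the class `GAUSS(n = 1 + (4m - 1), Λ_{3m})`. -/
def firstExponent (m : ℕ) (k : Fin (4 * m - 1) → ℤ) : ℤ :=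
  (4 * (m : ℤ) - 1) * kappa k + lin m k

/-- The exponent of `q` in the class `GAUSS(n = m + 3m, Λ_{4m-1})`. -/
def secondExponent (m : ℕ) (k : Fin (4 * m - 1) → ℤ) : ℤ :=
  3 * (m : ℤ) * kappa k + linTilde m k

/-- The product side `φ(q^{4m-1})^{4m-1} φ(q^{2m})² / (φ(q) φ(q^m))`. -/
def firstProduct {R : Type*} [CommRing R] [TopologicalSpace R] [Inv R] (m : ℕ) (q : R) : R :=
  eulerPhi (q ^ (4 * m - 1)) ^ (4 * m - 1) * eulerPhi (q ^ (2 * m)) ^ 2 *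
    (eulerPhi q * eulerPhi (q ^ m))⁻¹

/-- The product side `φ(q^{3m})^{4m} φ(q²)² / (φ(q)² φ(q³))`. -/
def secondProduct {R : Type*} [CommRing R] [TopologicalSpace R] [Inv R] (m : ℕ) (q : R) : R :=
  eulerPhi (q ^ (3 * m)) ^ (4 * m) * eulerPhi (q ^ 2) ^ 2 *
    (eulerPhi q ^ 2 * eulerPhi (q ^ 3))⁻¹

end GaussSeries

end

/-!
In the coordinates `x_j = k_{j+1} - k_j` of the root lattice `A_{4m-1}` one has
`κ(k) = ∑ x_j (x_j - 1) / 2` and `∑ x_j = 0`, so the series is the constant term in `z` of a product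
of `4m` theta functions `θ(q^{3m}, z q^w)`, where `θ(q, z) = ∑ q^{a(a-1)/2} z^a` and `w` runs over
`2, 5, …, 3m - 1` and over `0, 1, …, 3m - 1`. By Jacobi's triple product each of the two runs
collapses to a single theta function, `θ(q³, z q²)` and `θ(q, z)`, up to a factor independent of
`z`. The constant term of `θ(q, z) θ(q³, z q²)` is `∑ q^{2a² - a}`, Gauss's series of triangular
numbers, which is `φ(q²)² / φ(q)` by the triple product again. Formal power series that agree as
functions near `0` are equal, and this gives the formal identity.
-/

namespace GaussSeries

open Filter Topology Finset

/-! ### The `q`-binomial theorem -/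

/-- The Gaussian binomial coefficient, defined by its Pascal rule so that it makes sense in every
commutative semiring and for every `q`. -/
def qBinom {R : Type*} [CommSemiring R] (q : R) : ℕ → ℕ → R
  | _, 0 => 1
  | 0, _ + 1 => 0
  | n + 1, r + 1 => qBinom q n r + q ^ (r + 1) * qBinom q n (r + 1)

/-- The finite product `(1 - q) (1 - q ^ 2) ⋯ (1 - q ^ n)`, which is `(q; q)_n` in the usual
notation. -/
def eulerProd {R : Type*} [CommRing R] (q : R) (n : ℕ) : R :=
  ∏ i ∈ range n, (1 - q ^ (i + 1))

section CommSemiring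

variable {R : Type*} [CommSemiring R] (q : R)

theorem qBinom_zero_right (n : ℕ) : qBinom q n 0 = 1 := by
  cases n <;> rfl

theorem qBinom_succ_succ (n r : ℕ) :
    qBinom q (n + 1) (r + 1) = qBinom q n r + q ^ (r + 1) * qBinom q n (r + 1) :=
  rfl

theorem qBinom_eq_zero_of_lt {n r : ℕ} (h : n < r) : qBinom q n r = 0 := by
  induction n generalizing r with
  | zero => cases r with
    | zero => omega
    | succ r => rfl
  | succ n ih => cases r with
    | zero => omega
    | succ r => rw [qBinom_succ_succ, ih (by omega), ih (by omega), mul_zero, add_zero]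

theorem prod_one_add_mul_pow_eq_sum_qBinom (w : R) (n : ℕ) :
    ∏ i ∈ range n, (1 + w * q ^ i) =
      ∑ r ∈ range (n + 1), qBinom q n r * q ^ r.choose 2 * w ^ r := by
  induction n generalizing w with
  | zero => simp [qBinom_zero_right]
  | succ n ih =>
    have hshift : ∏ i ∈ range n, (1 + w * q ^ (i + 1)) =
        ∑ r ∈ range (n + 1), qBinom q n r * q ^ r.choose 2 * (w * q) ^ r := by
      rw [← ih]
      exact prod_congr rfl fun i _ => by ring
    have hpascal : ∀ r, qBinom q (n + 1) (r + 1) * q ^ (r + 1).choose 2 * w ^ (r + 1) =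
        w * (qBinom q n r * q ^ r.choose 2 * (w * q) ^ r) +
          qBinom q n (r + 1) * q ^ (r + 1).choose 2 * (w * q) ^ (r + 1) := fun r => by
      rw [qBinom_succ_succ, Nat.choose_succ_succ' r 1, Nat.choose_one_right]
      ring
    have hextend :
        ∑ r ∈ range (n + 1), qBinom q n (r + 1) * q ^ (r + 1).choose 2 * (w * q) ^ (r + 1) + 1 =
          ∑ r ∈ range (n + 1), qBinom q n r * q ^ r.choose 2 * (w * q) ^ r := by
      rw [sum_range_succ, qBinom_eq_zero_of_lt q n.lt_succ_self, sum_range_succ' _ n]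
      simp [qBinom_zero_right]
    have hzero : qBinom q (n + 1) 0 * q ^ Nat.choose 0 2 * w ^ 0 = 1 := by
      simp [qBinom_zero_right]
    rw [prod_range_succ', hshift, pow_zero, mul_one, sum_range_succ' _ (n + 1), hzero,
      sum_congr rfl fun r _ => hpascal r, sum_add_distrib, ← mul_sum, add_assoc, hextend]
    ring

end CommSemiring

section CommRing

variable {R : Type*} [CommRing R] (q : R)

theorem eulerProd_succ (n : ℕ) : eulerProd q (n + 1) = eulerProd q n * (1 - q ^ (n + 1)) :=
  prod_range_succ _ _

theorem qBinom_add_mul_eulerProd (r s : ℕ) :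
    qBinom q (r + s) r * (eulerProd q r * eulerProd q s) = eulerProd q (r + s) := by
  induction r generalizing s with
  | zero => simp [qBinom_zero_right, eulerProd]
  | succ r ihr => induction s with
    | zero =>
      have hr := ihr 0
      simp only [add_zero, eulerProd, prod_range_zero, mul_one] at hr ⊢
      rw [qBinom_succ_succ, qBinom_eq_zero_of_lt q r.lt_succ_self, mul_zero, add_zero,
        prod_range_succ, ← mul_assoc, hr]
    | succ s ihs =>
      have hr := ihr (s + 1)
      rw [show r + 1 + (s + 1) = (r + (s + 1)) + 1 by omega, qBinom_succ_succ, eulerProd_succ q r,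
        eulerProd_succ q s, eulerProd_succ q (r + (s + 1))]
      rw [show r + 1 + s = r + (s + 1) by omega, eulerProd_succ q r] at ihs
      rw [eulerProd_succ q s] at hr
      linear_combination (1 - q ^ (r + 1)) * hr + q ^ (r + 1) * (1 - q ^ (s + 1)) * ihs

end CommRing

/-! ### Jacobi's triple product -/

/-- The exponent `a (a - 1) / 2` of the theta series, a binomial coefficient for `a ≥ 0` and an
integer for every integer `a`. -/
def tri (a : ℤ) : ℤ := a * (a - 1) / 2

theorem two_mul_tri (a : ℤ) : 2 * tri a = a * (a - 1) :=
  Int.mul_ediv_cancel' (Int.even_mul_pred_self a).two_dvd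

theorem tri_add (a b : ℤ) : tri (a + b) = tri a + tri b + a * b := by
  linarith [two_mul_tri (a + b), two_mul_tri a, two_mul_tri b]

theorem tri_neg (a : ℤ) : tri (-a) = tri a + a := by
  linarith [two_mul_tri (-a), two_mul_tri a]

theorem tri_natCast (n : ℕ) : tri n = (n.choose 2 : ℕ) := by
  induction n with
  | zero => rfl
  | succ n ih =>
    rw [Nat.cast_succ, tri_add, ih, Nat.choose_succ_succ' n 1, Nat.choose_one_right]
    push_cast
    simp [tri]
    ring

section Field

variable {K : Type*} [Field K] {q z : K}

theorem prod_range_mul_inv_pow (hq : q ≠ 0) (n : ℕ) :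
    ∏ i ∈ range n, z * (q ^ (i + 1))⁻¹ = z ^ n * q ^ (-tri (-n)) := by
  induction n with
  | zero => simp [tri]
  | succ n ih =>
    have hexp : -tri (-(n + 1 : ℕ)) = -tri (-n) - (n + 1 : ℕ) := by
      push_cast
      rw [neg_add, tri_add]
      simp [tri]
      ring
    rw [prod_range_succ, ih, hexp, zpow_sub₀ hq, zpow_natCast]
    ring

theorem prod_range_two_mul_one_add (hq : q ≠ 0) (hz : z ≠ 0) (n : ℕ) :
    ∏ i ∈ range (2 * n), (1 + z * (q ^ n)⁻¹ * q ^ i) =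
      z ^ n * q ^ (-tri (-n)) *
        ((∏ i ∈ range n, (1 + z * q ^ i)) * ∏ i ∈ range n, (1 + z⁻¹ * q ^ (i + 1))) := by
  have hlow : ∏ i ∈ range n, (1 + z * (q ^ n)⁻¹ * q ^ i) =
      z ^ n * q ^ (-tri (-n)) * ∏ i ∈ range n, (1 + z⁻¹ * q ^ (i + 1)) := by
    rw [← prod_range_mul_inv_pow hq, ← prod_mul_distrib, ← prod_range_reflect]
    refine prod_congr rfl fun i hi => ?_
    have hpow : q ^ n = q ^ (n - 1 - i) * q ^ (i + 1) := by
      rw [← pow_add]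
      have := mem_range.mp hi
      congr 1
      omega
    rw [hpow]
    field_simp
    ring
  have hhigh : ∏ i ∈ range n, (1 + z * (q ^ n)⁻¹ * q ^ (n + i)) =
      ∏ i ∈ range n, (1 + z * q ^ i) :=
    prod_congr rfl fun i _ => by rw [pow_add]; field_simp
  rw [two_mul, prod_range_add, hlow, hhigh]
  ring

theorem prod_mul_prod_eq_sum_qBinom (hq : q ≠ 0) (hz : z ≠ 0) (n : ℕ) :
    (∏ i ∈ range n, (1 + z * q ^ i)) * ∏ i ∈ range n, (1 + z⁻¹ * q ^ (i + 1)) =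
      ∑ r ∈ range (2 * n + 1),
        qBinom q (2 * n) r * (q ^ tri (r - n : ℤ) * z ^ (r - n : ℤ)) := by
  have hne : z ^ n * q ^ (-tri (-n)) ≠ 0 := mul_ne_zero (pow_ne_zero _ hz) (zpow_ne_zero _ hq)
  rw [← mul_right_inj' hne, ← prod_range_two_mul_one_add hq hz,
    prod_one_add_mul_pow_eq_sum_qBinom, mul_sum]
  refine sum_congr rfl fun r _ => ?_
  have htri : tri (r - n : ℤ) = r.choose 2 + tri (-n) - n * r := by
    rw [sub_eq_add_neg, tri_add, tri_natCast]
    ring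
  have hq_exp : q ^ r.choose 2 * (q ^ n)⁻¹ ^ r = q ^ (-tri (-n)) * q ^ tri (r - n : ℤ) := by
    rw [← zpow_add₀ hq, htri, inv_pow, ← pow_mul, ← zpow_natCast, ← zpow_natCast, ← zpow_neg,
      ← zpow_add₀ hq]
    congr 1
    push_cast
    ring
  have hz_exp : z ^ r = z ^ n * z ^ (r - n : ℤ) := by
    rw [← zpow_natCast z n, ← zpow_add₀ hz, add_sub_cancel, zpow_natCast]
  rw [mul_pow, hz_exp]
  linear_combination qBinom q (2 * n) r * z ^ n * z ^ (r - n : ℤ) * hq_exp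

theorem prod_mul_prod_eq_tsum_qBinom [TopologicalSpace K] (hq : q ≠ 0) (hz : z ≠ 0) (n : ℕ) :
    (∏ i ∈ range n, (1 + z * q ^ i)) * ∏ i ∈ range n, (1 + z⁻¹ * q ^ (i + 1)) =
      ∑' a : ℤ, Set.indicator (Set.Ici (-n : ℤ)) (fun a => qBinom q (2 * n) (n + a).toNat) a *
        (q ^ tri a * z ^ a) := by
  have hinj : Function.Injective fun r : ℕ => (r - n : ℤ) := fun a b h => by simpa using h
  rw [prod_mul_prod_eq_sum_qBinom hq hz, tsum_eq_sum (s := (range (2 * n + 1)).map ⟨_, hinj⟩),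
    sum_map]
  · exact sum_congr rfl fun r _ => by simp
  · intro a ha
    by_cases h : -n ≤ a
    · have hr : 2 * n < (n + a).toNat := by
        by_contra hle
        exact ha (mem_map.mpr ⟨(n + a).toNat, mem_range.mpr (by omega), by simp; omega⟩)
      rw [Set.indicator_of_mem (Set.mem_Ici.mpr h), qBinom_eq_zero_of_lt q hr, zero_mul]
    · rw [Set.indicator_of_notMem (by simpa using h), zero_mul]

end Field

/-- The infinite product `∏_{j ≥ 0} (1 + w q ^ j)`, which is `(-w; q)_∞` in the usual notation. -/
noncomputable def qProd {R : Type*} [CommRing R] [TopologicalSpace R] (w q : R) : R :=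
  ∏' j : ℕ, (1 + w * q ^ j)

/-- The product side of Jacobi's triple product identity, whose series side is
`∑ q ^ (a (a - 1) / 2) z ^ a` over all integers `a`. -/
noncomputable def jacobiProd {K : Type*} [Field K] [TopologicalSpace K] (q z : K) : K :=
  eulerPhi q * (qProd z q * qProd (z⁻¹ * q) q)

theorem eulerPhi_eq_qProd {R : Type*} [CommRing R] [TopologicalSpace R] (q : R) :
    eulerPhi q = qProd (-q) q :=
  tprod_congr fun j => by ring

section NormedField

variable {K : Type*} [NormedField K] {q z : K}

theorem norm_pow_lt_one (hq : ‖q‖ < 1) {n : ℕ} (hn : n ≠ 0) : ‖q ^ n‖ < 1 := by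
  rw [norm_pow]
  exact pow_lt_one₀ (norm_nonneg q) hq hn

theorem one_sub_pow_ne_zero (hq : ‖q‖ < 1) {n : ℕ} (hn : n ≠ 0) : 1 - q ^ n ≠ 0 := by
  intro h
  have hlt := norm_pow_lt_one hq hn
  rw [← sub_eq_zero.mp h, norm_one] at hlt
  exact lt_irrefl _ hlt

theorem eulerProd_ne_zero (hq : ‖q‖ < 1) (n : ℕ) : eulerProd q n ≠ 0 :=
  prod_ne_zero_iff.mpr fun i _ => one_sub_pow_ne_zero hq i.succ_ne_zero

theorem qBinom_add_eq_div (hq : ‖q‖ < 1) (r s : ℕ) :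
    qBinom q (r + s) r = eulerProd q (r + s) / (eulerProd q r * eulerProd q s) :=
  eq_div_of_mul_eq (mul_ne_zero (eulerProd_ne_zero hq r) (eulerProd_ne_zero hq s))
    (qBinom_add_mul_eulerProd q r s)

theorem summable_norm_mul_pow (hq : ‖q‖ < 1) (w : K) : Summable fun j : ℕ => ‖w * q ^ j‖ := by
  simpa only [norm_mul, norm_pow] using
    (summable_geometric_of_lt_one (norm_nonneg q) hq).mul_left ‖w‖

theorem summable_pow_choose_two_mul_pow {r s : ℝ} (hr₀ : 0 < r) (hr : r < 1) (hs : 0 < s) :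
    Summable fun n : ℕ => r ^ n.choose 2 * s ^ n := by
  refine summable_of_ratio_test_tendsto_lt_one (l := 0) one_pos
    (Eventually.of_forall fun n => by positivity) ?_
  have hlim : Tendsto (fun n : ℕ => r ^ n * s) atTop (𝓝 0) := by
    simpa using (tendsto_pow_atTop_nhds_zero_of_lt_one hr₀.le hr).mul_const s
  refine hlim.congr fun n => ?_
  rw [Real.norm_of_nonneg (by positivity), Real.norm_of_nonneg (by positivity),
    Nat.choose_succ_succ' n 1, Nat.choose_one_right, pow_add, pow_succ]
  field_simp

theorem summable_norm_theta (hq : ‖q‖ < 1) (hq₀ : q ≠ 0) (hz : z ≠ 0) :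
    Summable fun a : ℤ => ‖q ^ tri a * z ^ a‖ := by
  have hqpos : 0 < ‖q‖ := norm_pos_iff.mpr hq₀
  have hzpos : 0 < ‖z‖ := norm_pos_iff.mpr hz
  apply Summable.of_nat_of_neg
  · refine (summable_pow_choose_two_mul_pow hqpos hq hzpos).congr fun n => ?_
    rw [tri_natCast, zpow_natCast, zpow_natCast, norm_mul, norm_pow, norm_pow]
  · refine (summable_pow_choose_two_mul_pow hqpos hq
      (s := ‖q‖ * ‖z‖⁻¹) (by positivity)).congr fun n => ?_
    rw [tri_neg, tri_natCast, ← Nat.cast_add, zpow_natCast, zpow_neg, zpow_natCast, norm_mul,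
      norm_pow, norm_inv, norm_pow, pow_add, mul_pow, inv_pow]
    ring

variable [CompleteSpace K]

theorem multipliable_one_add_mul_pow (hq : ‖q‖ < 1) (w : K) :
    Multipliable fun j : ℕ => 1 + w * q ^ j :=
  multipliable_one_add_of_summable (summable_norm_mul_pow hq w)

theorem tendsto_prod_one_add_mul_pow (hq : ‖q‖ < 1) (w : K) :
    Tendsto (fun n => ∏ j ∈ range n, (1 + w * q ^ j)) atTop (𝓝 (qProd w q)) :=
  (multipliable_one_add_mul_pow hq w).hasProd.tendsto_prod_nat

theorem tendsto_eulerProd (hq : ‖q‖ < 1) : Tendsto (eulerProd q) atTop (𝓝 (eulerPhi q)) := by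
  rw [eulerPhi_eq_qProd]
  exact (tendsto_prod_one_add_mul_pow hq (-q)).congr fun n => prod_congr rfl fun i _ => by ring

theorem eulerPhi_ne_zero (hq : ‖q‖ < 1) : eulerPhi q ≠ 0 := by
  rw [eulerPhi_eq_qProd]
  refine tprod_one_add_ne_zero_of_summable (fun j => ?_) (summable_norm_mul_pow hq (-q))
  rw [neg_mul, ← sub_eq_add_neg, ← pow_succ']
  exact one_sub_pow_ne_zero hq j.succ_ne_zero

theorem exists_norm_qBinom_le (hq : ‖q‖ < 1) : ∃ C, ∀ n r, ‖qBinom q n r‖ ≤ C := by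
  obtain ⟨A, hA⟩ := (Metric.isBounded_range_of_tendsto _ (tendsto_eulerProd hq)).exists_norm_le
  obtain ⟨B, hB⟩ := (Metric.isBounded_range_of_tendsto _
    ((tendsto_eulerProd hq).inv₀ (eulerPhi_ne_zero hq))).exists_norm_le
  rw [Set.forall_mem_range] at hA hB
  have hA₀ : 0 ≤ A := (norm_nonneg _).trans (hA 0)
  have hB₀ : 0 ≤ B := (norm_nonneg _).trans (hB 0)
  refine ⟨A * (B * B), fun n r => ?_⟩
  rcases lt_or_ge n r with h | h
  · rw [qBinom_eq_zero_of_lt q h, norm_zero]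
    positivity
  · obtain ⟨s, rfl⟩ := Nat.exists_eq_add_of_le h
    rw [qBinom_add_eq_div hq, div_eq_mul_inv, mul_inv, norm_mul, norm_mul]
    gcongr
    exacts [hA _, hB _, hB _]

theorem tendsto_qBinom_add (hq : ‖q‖ < 1) {r s : ℕ → ℕ} (hr : Tendsto r atTop atTop)
    (hs : Tendsto s atTop atTop) :
    Tendsto (fun n => qBinom q (r n + s n) (r n)) atTop (𝓝 (eulerPhi q)⁻¹) := by
  have hφ := eulerPhi_ne_zero hq
  have hlim := tendsto_eulerProd hq
  simp_rw [qBinom_add_eq_div hq]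
  have hrs : Tendsto (fun n => r n + s n) atTop atTop :=
    tendsto_atTop_mono (fun n => Nat.le_add_right _ _) hr
  have hdiv := (hlim.comp hrs).div ((hlim.comp hr).mul (hlim.comp hs)) (mul_ne_zero hφ hφ)
  rwa [div_mul_cancel_left₀ hφ] at hdiv

theorem tendsto_qBinom_two_mul (hq : ‖q‖ < 1) (a : ℤ) :
    Tendsto (fun n : ℕ => Set.indicator (Set.Ici (-n : ℤ))
      (fun a => qBinom q (2 * n) (n + a).toNat) a) atTop (𝓝 (eulerPhi q)⁻¹) := by
  have hadd : ∀ b : ℤ, Tendsto (fun n : ℕ => (n + b).toNat) atTop atTop := fun b =>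
    tendsto_atTop_atTop.mpr fun c => ⟨c + b.natAbs, fun n hn => by omega⟩
  refine (tendsto_qBinom_add hq (hadd a) (hadd (-a))).congr' ?_
  filter_upwards [eventually_ge_atTop a.natAbs] with n hn
  rw [Set.indicator_of_mem (Set.mem_Ici.mpr (by omega)),
    show (n + a).toNat + (n + -a).toNat = 2 * n by omega]

theorem tendsto_tsum_qBinom (hq : ‖q‖ < 1) (hq₀ : q ≠ 0) (hz : z ≠ 0) :
    Tendsto (fun n : ℕ => ∑' a : ℤ, Set.indicator (Set.Ici (-n : ℤ))
        (fun a => qBinom q (2 * n) (n + a).toNat) a * (q ^ tri a * z ^ a))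
      atTop (𝓝 (∑' a : ℤ, (eulerPhi q)⁻¹ * (q ^ tri a * z ^ a))) := by
  obtain ⟨C, hC⟩ := exists_norm_qBinom_le hq
  refine tendsto_tsum_of_dominated_convergence ((summable_norm_theta hq hq₀ hz).mul_left C)
    (fun a => (tendsto_qBinom_two_mul hq a).mul_const _) (.of_forall fun n a => ?_)
  rw [norm_mul]
  gcongr
  exact (norm_indicator_le_norm_self _ _).trans (hC _ _)

theorem hasSum_jacobiProd (hq : ‖q‖ < 1) (hq₀ : q ≠ 0) (hz : z ≠ 0) :
    HasSum (fun a : ℤ => q ^ tri a * z ^ a) (jacobiProd q z) := by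
  have hprod : Tendsto (fun n => (∏ i ∈ range n, (1 + z * q ^ i)) *
      ∏ i ∈ range n, (1 + z⁻¹ * q ^ (i + 1))) atTop (𝓝 (qProd z q * qProd (z⁻¹ * q) q)) := by
    refine (tendsto_prod_one_add_mul_pow hq z).mul
      ((tendsto_prod_one_add_mul_pow hq (z⁻¹ * q)).congr fun n => ?_)
    exact prod_congr rfl fun i _ => by ring
  simp_rw [prod_mul_prod_eq_tsum_qBinom hq₀ hz] at hprod
  have heq := tendsto_nhds_unique hprod (tendsto_tsum_qBinom hq hq₀ hz)
  rw [jacobiProd, heq, tsum_mul_left, mul_inv_cancel_left₀ (eulerPhi_ne_zero hq)]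
  exact (summable_norm_theta hq hq₀ hz).of_norm.hasSum

end NormedField

/-! ### Dissection of infinite products -/

theorem prod_range_mul_eq_prod_prod {M : Type*} [CommMonoid M] (f : ℕ → M) (N n : ℕ) :
    ∏ k ∈ range (N * n), f k = ∏ i ∈ range N, ∏ j ∈ range n, f (N * j + i) := by
  induction n with
  | zero => simp
  | succ n ih =>
    rw [Nat.mul_succ, prod_range_add, ih, ← prod_mul_distrib]
    simp_rw [prod_range_succ]

section NormedField

variable {K : Type*} [NormedField K] [CompleteSpace K] {q z : K}

theorem prod_qProd (hq : ‖q‖ < 1) (w : K) {N : ℕ} (hN : N ≠ 0) :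
    ∏ i ∈ range N, qProd (w * q ^ i) (q ^ N) = qProd w q := by
  have hclasses : Tendsto (fun n => ∏ i ∈ range N, ∏ j ∈ range n, (1 + w * q ^ i * (q ^ N) ^ j))
      atTop (𝓝 (∏ i ∈ range N, qProd (w * q ^ i) (q ^ N))) :=
    tendsto_finsetProd _ fun i _ => tendsto_prod_one_add_mul_pow (norm_pow_lt_one hq hN) _
  have hall : Tendsto (fun n => ∏ k ∈ range (N * n), (1 + w * q ^ k)) atTop (𝓝 (qProd w q)) :=
    (tendsto_prod_one_add_mul_pow hq w).comp (tendsto_id.const_mul_atTop' hN.bot_lt)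
  refine tendsto_nhds_unique hclasses (hall.congr fun n => ?_)
  rw [prod_range_mul_eq_prod_prod]
  exact prod_congr rfl fun i _ => prod_congr rfl fun j _ => by ring

theorem prod_jacobiProd (hq : ‖q‖ < 1) (hq₀ : q ≠ 0) {N : ℕ} (hN : N ≠ 0) :
    ∏ i ∈ range N, jacobiProd (q ^ N) (z * q ^ i) =
      eulerPhi (q ^ N) ^ N * (eulerPhi q)⁻¹ * jacobiProd q z := by
  have hreflect : ∏ i ∈ range N, qProd ((z * q ^ i)⁻¹ * q ^ N) (q ^ N) = qProd (z⁻¹ * q) q := by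
    rw [← prod_qProd hq _ hN, ← prod_range_reflect]
    refine prod_congr rfl fun i hi => ?_
    have hpow : q ^ N = q ^ (N - 1 - i) * (q * q ^ i) := by
      rw [← pow_succ', ← pow_add]
      have := mem_range.mp hi
      congr 1
      omega
    congr 1
    rw [hpow]
    field_simp
  simp only [jacobiProd]
  rw [prod_mul_distrib, prod_mul_distrib, prod_qProd hq z hN, hreflect, prod_const, card_range]
  field_simp [eulerPhi_ne_zero hq]

theorem eulerPhi_sq (hq : ‖q‖ < 1) : eulerPhi (q ^ 2) = eulerPhi q * qProd q q := by
  simp only [eulerPhi_eq_qProd, qProd]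
  rw [← (multipliable_one_add_mul_pow hq (-q)).tprod_mul (multipliable_one_add_mul_pow hq q)]
  exact tprod_congr fun j => by ring

/-- Gauss's evaluation of the generating function of the triangular numbers. -/
theorem jacobiProd_pow_four_self (hq : ‖q‖ < 1) (hq₀ : q ≠ 0) :
    jacobiProd (q ^ 4) q = eulerPhi (q ^ 2) ^ 2 * (eulerPhi q)⁻¹ := by
  have hq2 : ‖q ^ 2‖ < 1 := norm_pow_lt_one hq two_ne_zero
  have hodd : qProd q (q ^ 4) * qProd (q⁻¹ * q ^ 4) (q ^ 4) = qProd q (q ^ 2) := by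
    rw [← prod_qProd hq2 q two_ne_zero, prod_range_succ, prod_range_one]
    congr 2 <;> field_simp
  have hall : qProd q (q ^ 2) * qProd (q ^ 2) (q ^ 2) = qProd q q := by
    rw [← prod_qProd hq q two_ne_zero, prod_range_succ, prod_range_one]
    congr 2 <;> ring
  have hfour : eulerPhi (q ^ 4) = eulerPhi (q ^ 2) * qProd (q ^ 2) (q ^ 2) := by
    rw [← eulerPhi_sq hq2, ← pow_mul]
  rw [jacobiProd, hodd, eq_mul_inv_iff_mul_eq₀ (eulerPhi_ne_zero hq), hfour]
  linear_combination (eulerPhi q * eulerPhi (q ^ 2)) * hall - eulerPhi (q ^ 2) * eulerPhi_sq hq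

end NormedField

/-! ### Constant terms of Laurent series -/

section NormedCommRing

variable {ι R : Type*} [NormedCommRing R] {n : ℕ} {f : Fin n → ι → R}

theorem summable_norm_prod_apply (hf : ∀ i, Summable fun a => ‖f i a‖) :
    Summable fun x : Fin n → ι => ‖∏ i, f i (x i)‖ := by
  induction n with
  | zero => exact (hasSum_fintype _).summable
  | succ n ih =>
    rw [← (Fin.consEquiv fun _ => ι).summable_iff]
    refine ((hf 0).mul_norm (ih fun i => hf i.succ)).congr fun p => ?_
    simp [Fin.consEquiv, Fin.prod_univ_succ]

theorem hasSum_prod_apply [CompleteSpace R] (hf : ∀ i, Summable fun a => ‖f i a‖) :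
    HasSum (fun x : Fin n → ι => ∏ i, f i (x i)) (∏ i, ∑' a, f i a) := by
  induction n with
  | zero => simp
  | succ n ih =>
    have htail : ∀ i : Fin n, Summable fun a => ‖f i.succ a‖ := fun i => hf i.succ
    rw [← (Fin.consEquiv fun _ => ι).hasSum_iff, Fin.prod_univ_succ]
    refine ((hf 0).of_norm.hasSum.mul (ih htail)
      ((hf 0).mul_norm (summable_norm_prod_apply htail)).of_norm).congr_fun fun p => ?_
    simp [Fin.consEquiv, Fin.prod_univ_succ]

end NormedCommRing

theorem circleAverage_zpow (n : ℤ) :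
    Real.circleAverage (fun z : ℂ => z ^ n) 0 1 = if n = 0 then 1 else 0 := by
  split_ifs with hn
  · simpa [hn] using Real.circleAverage_const (1 : ℂ) 0 1
  · have hint : (∮ z in C(0, 1), (z - 0 : ℂ)⁻¹ • z ^ n) = ∮ z in C(0, 1), (z - 0) ^ (n - 1) := by
      refine circleIntegral.integral_congr zero_le_one fun z hz => ?_
      have hz₀ : z ≠ 0 := ne_zero_of_mem_unit_sphere ⟨z, hz⟩
      simp only [sub_zero, smul_eq_mul]
      rw [zpow_sub_one₀ hz₀, mul_comm]
    rw [Real.circleAverage_eq_circleIntegral one_ne_zero, hint,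
      circleIntegral.integral_sub_zpow_of_ne (by omega), smul_zero]

theorem hasSum_circleAverage_laurent {ι : Type*} [Countable ι] {g : ι → ℂ}
    (hg : Summable fun i => ‖g i‖) (e : ι → ℤ) :
    HasSum (fun i => if e i = 0 then g i else 0)
      (Real.circleAverage (fun z => ∑' i, g i * z ^ e i) 0 1) := by
  have hmem : ∀ θ, ‖circleMap 0 1 θ‖ = 1 := fun θ => by simp
  have hnorm : ∀ i θ, ‖g i * circleMap 0 1 θ ^ e i‖ = ‖g i‖ := fun i θ => by
    rw [norm_mul, norm_zpow, hmem, one_zpow, mul_one]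
  have hcont : ∀ i, Continuous fun θ => g i * circleMap 0 1 θ ^ e i := fun i =>
    continuous_const.mul <| (continuous_circleMap 0 1).zpow₀ (e i) fun θ =>
      .inl <| norm_ne_zero_iff.mp <| by simp [hmem]
  have hterm : ∀ i, Real.circleAverage (fun z => g i * z ^ e i) 0 1 =
      if e i = 0 then g i else 0 := fun i => by
    have hsmul := Real.circleAverage_fun_smul (a := g i) (f := fun z : ℂ => z ^ e i) (c := 0)
      (R := 1)
    simp only [smul_eq_mul] at hsmul
    rw [hsmul, circleAverage_zpow, mul_ite, mul_one, mul_zero]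
  simp_rw [← hterm, Real.circleAverage_def]
  refine HasSum.const_smul _ <| intervalIntegral.hasSum_integral_of_dominated_convergence
    (fun i _ => ‖g i‖) (fun i => (hcont i).aestronglyMeasurable)
    (fun i => .of_forall fun θ _ => (hnorm i θ).le) (.of_forall fun θ _ => hg) (by simp)
    (.of_forall fun θ _ => Summable.hasSum (.of_norm ?_))
  simpa only [hnorm] using hg

/-! ### Theta series of the root lattice `A_n` -/

/-- The coordinates `k_{j+1} - k_j` (with `k_0 = k_{n+1} = 0`) of the element of the root lattice
`A_n` whose coefficients in the basis of simple roots are `k_1, …, k_n`. -/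
def rootCoord {n : ℕ} (k : Fin n → ℤ) (j : Fin (n + 1)) : ℤ :=
  Fin.snoc (α := fun _ => ℤ) k 0 j - Fin.cons (α := fun _ => ℤ) 0 k j

theorem sum_mul_rootCoord {n : ℕ} (d : ℕ → ℤ) (k : Fin n → ℤ) :
    ∑ j : Fin (n + 1), d j * rootCoord k j = ∑ i : Fin n, (d i - d (i + 1)) * k i := by
  simp only [rootCoord, mul_sub, sub_mul, sum_sub_distrib]
  rw [Fin.sum_univ_castSucc,
    Fin.sum_univ_succ fun j : Fin (n + 1) => d j * Fin.cons (α := fun _ => ℤ) 0 k j]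
  simp

theorem sum_rootCoord {n : ℕ} (k : Fin n → ℤ) : ∑ j, rootCoord k j = 0 := by
  simpa using sum_mul_rootCoord (fun _ => 1) k

theorem rootCoord_injective (n : ℕ) : Function.Injective (rootCoord (n := n)) := by
  have hpartial : ∀ (k : Fin n → ℤ) (i : Fin n),
      ∑ j : Fin (n + 1), (if (j : ℕ) ≤ i then 1 else 0) * rootCoord k j = k i := fun k i => by
    rw [sum_mul_rootCoord (fun j => if j ≤ (i : ℕ) then 1 else 0), Fintype.sum_eq_single i]
    · simp
    · intro j hj
      have hj' : (j : ℕ) ≠ i := Fin.val_ne_of_ne hj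
      rw [show (if (j : ℕ) ≤ i then 1 else 0 : ℤ) = if (j : ℕ) + 1 ≤ i then 1 else 0 by
        split_ifs <;> omega, sub_self, zero_mul]
  intro k l h
  ext i
  rw [← hpartial k, ← hpartial l, h]

theorem range_rootCoord (n : ℕ) : Set.range (rootCoord (n := n)) = {x | ∑ j, x j = 0} := by
  refine Set.Subset.antisymm (Set.range_subset_iff.mpr sum_rootCoord) fun x hx => ?_
  have hlast : Fin.partialSum x (Fin.last (n + 1)) = 0 := by
    simpa [Fin.partialSum, List.take_of_length_le, List.sum_ofFn, Fin.sum_univ_succ] using hx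
  refine ⟨fun i => Fin.partialSum x i.succ.castSucc, funext fun j => ?_⟩
  have hsnoc : Fin.snoc (α := fun _ => ℤ) (fun i => Fin.partialSum x i.succ.castSucc) 0 j =
      Fin.partialSum x j.succ := by
    induction j using Fin.lastCases with
    | last => rw [Fin.snoc_last, Fin.succ_last, hlast]
    | cast i => rw [Fin.snoc_castSucc, Fin.succ_castSucc]
  have hcons : Fin.cons (α := fun _ => ℤ) 0 (fun i => Fin.partialSum x i.succ.castSucc) j =
      Fin.partialSum x j.castSucc := by
    induction j using Fin.cases with
    | zero => simp
    | succ i => rw [Fin.cons_succ]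
  rw [rootCoord, hsnoc, hcons, Fin.partialSum_succ, add_sub_cancel_left]

theorem sum_rootCoord_sq {n : ℕ} (k : Fin n → ℤ) : ∑ j, rootCoord k j ^ 2 = 2 * kappa k := by
  cases n with
  | zero => simp [rootCoord, kappa, Fin.snoc]
  | succ n =>
    have hkappa : kappa k = ∑ i, k i ^ 2 - ∑ i : Fin n, k i.castSucc * k i.succ := rfl
    have hsnoc : ∑ j, Fin.snoc (α := fun _ => ℤ) k 0 j ^ 2 = ∑ i, k i ^ 2 := by
      rw [Fin.sum_univ_castSucc]
      simp
    have hcons : ∑ j, Fin.cons (α := fun _ => ℤ) 0 k j ^ 2 = ∑ i, k i ^ 2 := by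
      rw [Fin.sum_univ_succ]
      simp
    have hmixed : ∑ j, Fin.snoc (α := fun _ => ℤ) k 0 j * Fin.cons (α := fun _ => ℤ) 0 k j =
        ∑ i : Fin n, k i.castSucc * k i.succ := by
      rw [Fin.sum_univ_succ, Fin.sum_univ_castSucc]
      simp only [Fin.cons_zero, mul_zero, zero_add, Fin.succ_last, Fin.snoc_last, zero_mul,
        add_zero, Fin.succ_castSucc, Fin.snoc_castSucc]
      exact sum_congr rfl fun i _ => mul_comm _ _
    simp only [rootCoord, sub_sq, sum_add_distrib, sum_sub_distrib, mul_assoc, ← mul_sum]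
    rw [hsnoc, hcons, hmixed, hkappa]
    ring

theorem sum_tri_rootCoord {n : ℕ} (k : Fin n → ℤ) : ∑ j, tri (rootCoord k j) = kappa k := by
  have hsum : 2 * ∑ j, tri (rootCoord k j) = ∑ j, rootCoord k j ^ 2 - ∑ j, rootCoord k j := by
    rw [mul_sum, ← sum_sub_distrib]
    exact sum_congr rfl fun j _ => by rw [two_mul_tri]; ring
  rw [sum_rootCoord_sq, sum_rootCoord] at hsum
  linarith

theorem zpow_sum₀ {ι G₀ : Type*} [CommGroupWithZero G₀] {z : G₀} (hz : z ≠ 0) (s : Finset ι)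
    (e : ι → ℤ) : z ^ ∑ j ∈ s, e j = ∏ j ∈ s, z ^ e j := by
  classical
  induction s using Finset.induction_on with
  | empty => simp
  | insert a s ha ih => rw [sum_insert ha, prod_insert ha, zpow_add₀ hz, ih]

theorem hasSum_prod_theta {K : Type*} [NormedField K] [CompleteSpace K] {n : ℕ} {Q w : Fin n → K}
    (hQ : ∀ j, ‖Q j‖ < 1) (hQ₀ : ∀ j, Q j ≠ 0) (hw : ∀ j, w j ≠ 0) {z : K} (hz : z ≠ 0) :
    HasSum (fun x : Fin n → ℤ => (∏ j, Q j ^ tri (x j) * w j ^ x j) * z ^ ∑ j, x j)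
      (∏ j, jacobiProd (Q j) (z * w j)) := by
  have hzw : ∀ j, z * w j ≠ 0 := fun j => mul_ne_zero hz (hw j)
  have hprod := hasSum_prod_apply (f := fun j a => Q j ^ tri a * (z * w j) ^ a) fun j =>
    summable_norm_theta (hQ j) (hQ₀ j) (hzw j)
  rw [prod_congr rfl fun j _ => (hasSum_jacobiProd (hQ j) (hQ₀ j) (hzw j)).tsum_eq] at hprod
  refine hprod.congr_fun fun x => ?_
  rw [zpow_sum₀ hz, ← prod_mul_distrib]
  exact prod_congr rfl fun j _ => by rw [mul_zpow]; ring

theorem hasSum_theta_rootCoord {n : ℕ} {Q w : Fin (n + 1) → ℂ} (hQ : ∀ j, ‖Q j‖ < 1)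
    (hQ₀ : ∀ j, Q j ≠ 0) (hw : ∀ j, w j ≠ 0) :
    HasSum (fun k : Fin n → ℤ => ∏ j, Q j ^ tri (rootCoord k j) * w j ^ rootCoord k j)
      (Real.circleAverage (fun z => ∏ j, jacobiProd (Q j) (z * w j)) 0 1) := by
  have hconst := hasSum_circleAverage_laurent
    (summable_norm_prod_apply (f := fun j a => Q j ^ tri a * w j ^ a) fun j =>
      summable_norm_theta (hQ j) (hQ₀ j) (hw j))
    fun x => ∑ j, x j
  have htheta : Set.EqOn
      (fun z => ∑' x : Fin (n + 1) → ℤ, (∏ j, Q j ^ tri (x j) * w j ^ x j) * z ^ ∑ j, x j)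
      (fun z => ∏ j, jacobiProd (Q j) (z * w j)) (Metric.sphere 0 |1|) := fun z hz =>
    (hasSum_prod_theta hQ hQ₀ hw (ne_zero_of_mem_sphere (by simp) ⟨z, hz⟩)).tsum_eq
  rw [Real.circleAverage_congr_sphere htheta, ← (rootCoord_injective n).hasSum_iff] at hconst
  · exact hconst.congr_fun fun k => (if_pos (sum_rootCoord k)).symm
  · intro x hx
    rw [range_rootCoord] at hx
    exact if_neg hx

/-! ### The identity on the punctured disc -/

/-- The linear form `linTilde` in root coordinates: `2, 5, …, 3m - 1` followed by
`1, 2, …, 3m - 1, 0`. Up to order these are two runs of exponents, `2 + 3 * i` for `i < m` and `i`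
for `i < 3 * m`. -/
def weight (m j : ℕ) : ℕ :=
  if j < m then 2 + 3 * j else if j < 4 * m - 1 then j - m + 1 else 0

theorem weight_lt {m : ℕ} (hm : 0 < m) (j : ℕ) : weight m j < 3 * m := by
  unfold weight
  split_ifs <;> omega

theorem linTildeCoeff_eq_weight_sub_weight {m j : ℕ} (hj : j < 4 * m - 1) :
    linTildeCoeff m (j + 1) = (weight m j : ℤ) - weight m (j + 1) := by
  unfold linTildeCoeff weight
  split_ifs <;> omega

theorem secondExponent_eq_sum (m : ℕ) (k : Fin (4 * m - 1) → ℤ) :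
    secondExponent m k =
      ∑ j, (3 * (m : ℤ) * tri (rootCoord k j) + weight m j * rootCoord k j) := by
  have hlin : linTilde m k = ∑ j : Fin (4 * m - 1 + 1), (weight m j : ℤ) * rootCoord k j := by
    rw [sum_mul_rootCoord fun j => (weight m j : ℤ)]
    exact sum_congr rfl fun i _ => by rw [linTildeCoeff_eq_weight_sub_weight i.isLt]
  rw [sum_add_distrib, ← mul_sum, sum_tri_rootCoord, ← hlin, secondExponent]

theorem mul_tri_add_mul_nonneg {M d : ℤ} (hd : 0 ≤ d) (hdM : d ≤ M) (x : ℤ) :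
    0 ≤ M * tri x + d * x := by
  have htri := two_mul_tri x
  have htri_nonneg : 0 ≤ tri x := by
    rcases le_or_gt x 0 with hx | hx <;> nlinarith
  have htri_add_nonneg : 0 ≤ tri x + x := by
    rcases lt_or_ge x 0 with hx | hx <;> nlinarith
  have hsplit : M * tri x + d * x = (M - d) * tri x + d * (tri x + x) := by ring
  rw [hsplit]
  exact add_nonneg (mul_nonneg (sub_nonneg.mpr hdM) htri_nonneg) (mul_nonneg hd htri_add_nonneg)

theorem secondExponent_nonneg {m : ℕ} (hm : 0 < m) (k : Fin (4 * m - 1) → ℤ) :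
    0 ≤ secondExponent m k := by
  rw [secondExponent_eq_sum]
  exact sum_nonneg fun j _ =>
    mul_tri_add_mul_nonneg (by positivity) (by exact_mod_cast (weight_lt hm j).le) _

theorem prod_range_weight {M : Type*} [CommMonoid M] {m : ℕ} (hm : 0 < m) (f : ℕ → M) :
    ∏ j ∈ range (4 * m - 1 + 1), f (weight m j) =
      (∏ i ∈ range m, f (2 + 3 * i)) * ∏ i ∈ range (3 * m), f i := by
  have hfirst : ∏ j ∈ range m, f (weight m j) = ∏ i ∈ range m, f (2 + 3 * i) :=
    prod_congr rfl fun j hj => by rw [weight, if_pos (mem_range.mp hj)]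
  have hsecond : ∀ i ∈ range (3 * m - 1), f (weight m (m + i)) = f (i + 1) := fun i hi => by
    have hi' := mem_range.mp hi
    rw [weight, if_neg (by omega), if_pos (by omega), Nat.add_sub_cancel_left]
  have hlast : weight m (m + (3 * m - 1)) = 0 := by
    rw [weight, if_neg (by omega), if_neg (by omega)]
  obtain ⟨hN, hN'⟩ : 4 * m - 1 + 1 = m + (3 * m - 1 + 1) ∧ 3 * m = 3 * m - 1 + 1 := by omega
  rw [hN, prod_range_add, hfirst, prod_range_succ, hlast, prod_congr rfl hsecond,
    ← prod_range_succ', ← hN']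

theorem prod_jacobiProd_weight {K : Type*} [NormedField K] [CompleteSpace K] {q : K}
    (hq : ‖q‖ < 1) (hq₀ : q ≠ 0) {m : ℕ} (hm : 0 < m) (z : K) :
    ∏ j : Fin (4 * m - 1 + 1), jacobiProd (q ^ (3 * m)) (z * q ^ weight m j) =
      eulerPhi (q ^ (3 * m)) ^ (4 * m) * (eulerPhi q * eulerPhi (q ^ 3))⁻¹ *
        (jacobiProd q z * jacobiProd (q ^ 3) (z * q ^ 2)) := by
  have hrun₁ := prod_jacobiProd (z := z) hq hq₀ (N := 3 * m) (by omega)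
  have hrun₃ := prod_jacobiProd (z := z * q ^ 2) (norm_pow_lt_one hq three_ne_zero)
    (pow_ne_zero 3 hq₀) hm.ne'
  simp_rw [← pow_mul, mul_assoc, ← pow_add] at hrun₃
  rw [Fin.prod_univ_eq_prod_range fun j => jacobiProd (q ^ (3 * m)) (z * q ^ weight m j),
    prod_range_weight hm fun d => jacobiProd (q ^ (3 * m)) (z * q ^ d), hrun₁, hrun₃,
    show 4 * m = m + 3 * m by ring, pow_add, mul_inv]
  ring

theorem circleAverage_jacobiProd_mul_jacobiProd {q : ℂ} (hq : ‖q‖ < 1) (hq₀ : q ≠ 0) :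
    Real.circleAverage (fun z => jacobiProd q z * jacobiProd (q ^ 3) (z * q ^ 2)) 0 1 =
      jacobiProd (q ^ 4) q := by
  have hsum := hasSum_theta_rootCoord (Q := ![q, q ^ 3]) (w := ![1, q ^ 2])
    (Fin.forall_fin_two.mpr ⟨hq, norm_pow_lt_one hq three_ne_zero⟩)
    (Fin.forall_fin_two.mpr ⟨hq₀, pow_ne_zero 3 hq₀⟩)
    (Fin.forall_fin_two.mpr ⟨one_ne_zero, pow_ne_zero 2 hq₀⟩)
  have hterm : ∀ a : ℤ, q ^ tri a * ((q ^ 3) ^ tri (-a) * ((q ^ 2) ^ a)⁻¹) =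
      (q ^ 4) ^ tri a * q ^ a := fun a => by
    simp only [← zpow_natCast, ← zpow_mul, ← zpow_neg, ← zpow_add₀ hq₀, tri_neg]
    congr 1
    push_cast
    ring
  have hgauss := hasSum_jacobiProd (norm_pow_lt_one hq four_ne_zero) (pow_ne_zero 4 hq₀) hq₀
  rw [← (Equiv.funUnique (Fin 1) ℤ).hasSum_iff] at hgauss
  refine HasSum.unique ?_ hgauss
  simpa [rootCoord, Fin.snoc, hterm, Function.comp_def] using hsum

theorem zpow_secondExponent {G₀ : Type*} [CommGroupWithZero G₀] {q : G₀} (hq₀ : q ≠ 0) (m : ℕ)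
    (k : Fin (4 * m - 1) → ℤ) :
    q ^ secondExponent m k = ∏ j : Fin (4 * m - 1 + 1),
      (q ^ (3 * m)) ^ tri (rootCoord k j) * (q ^ weight m j) ^ rootCoord k j := by
  rw [secondExponent_eq_sum, zpow_sum₀ hq₀]
  refine prod_congr rfl fun j _ => ?_
  rw [← zpow_natCast, ← zpow_natCast, ← zpow_mul, ← zpow_mul, ← zpow_add₀ hq₀, Nat.cast_mul,
    Nat.cast_ofNat]

theorem hasSum_zpow_secondExponent {q : ℂ} (hq : ‖q‖ < 1) (hq₀ : q ≠ 0) {m : ℕ} (hm : 0 < m) :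
    HasSum (fun k : Fin (4 * m - 1) → ℤ => q ^ secondExponent m k) (secondProduct m q) := by
  have hsum := hasSum_theta_rootCoord (n := 4 * m - 1) (Q := fun _ => q ^ (3 * m))
    (w := fun j => q ^ weight m j) (fun _ => norm_pow_lt_one hq (by omega))
    (fun _ => pow_ne_zero _ hq₀) fun j => pow_ne_zero _ hq₀
  simp_rw [prod_jacobiProd_weight hq hq₀ hm, ← smul_eq_mul (_ * _⁻¹)] at hsum
  rw [Real.circleAverage_fun_smul, circleAverage_jacobiProd_mul_jacobiProd hq hq₀,
    jacobiProd_pow_four_self hq hq₀, smul_eq_mul] at hsum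
  have hprod : secondProduct m q = eulerPhi (q ^ (3 * m)) ^ (4 * m) *
      (eulerPhi q * eulerPhi (q ^ 3))⁻¹ * (eulerPhi (q ^ 2) ^ 2 * (eulerPhi q)⁻¹) := by
    rw [secondProduct, sq (eulerPhi q)]
    simp only [mul_inv]
    ring
  rw [hprod]
  exact hsum.congr_fun fun k => zpow_secondExponent hq₀ m k

/-! ### Formal power series and their values on the unit disc -/

/-- The formal power series `F` converges to the function `f` on the open unit disc. Identities
between functions on the disc are transferred to formal power series through this relation. -/
def ConvergesTo (F : ℂ⟦X⟧) (f : ℂ → ℂ) : Prop :=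
  ∀ q : ℂ, ‖q‖ < 1 → HasSum (fun n => F.coeff n * q ^ n) (f q)

namespace ConvergesTo

variable {F G : ℂ⟦X⟧} {f g : ℂ → ℂ}

theorem one : ConvergesTo 1 fun _ => 1 := fun q _ => by
  convert hasSum_single (f := fun n => (1 : ℂ⟦X⟧).coeff n * q ^ n) 0 fun n hn => ?_
  · simp
  · simp [PowerSeries.coeff_one, hn]

theorem mul (hF : ConvergesTo F f) (hG : ConvergesTo G g) :
    ConvergesTo (F * G) fun q => f q * g q := fun q hq => by
  have hF' := (hF q hq).summable.norm
  have hG' := (hG q hq).summable.norm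
  have hcoeff : ∀ n, (F * G).coeff n * q ^ n =
      ∑ p ∈ antidiagonal n, F.coeff p.1 * q ^ p.1 * (G.coeff p.2 * q ^ p.2) := fun n => by
    rw [PowerSeries.coeff_mul, sum_mul]
    refine sum_congr rfl fun p hp => ?_
    rw [← mem_antidiagonal.mp hp, pow_add]
    ring
  have hcauchy := tsum_mul_tsum_eq_tsum_sum_antidiagonal_of_summable_norm hF' hG'
  rw [(hF q hq).tsum_eq, (hG q hq).tsum_eq] at hcauchy
  simp_rw [hcoeff, hcauchy]
  exact (summable_norm_sum_mul_antidiagonal_of_summable_norm hF' hG').of_norm.hasSum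

theorem pow (hF : ConvergesTo F f) (n : ℕ) : ConvergesTo (F ^ n) fun q => f q ^ n := by
  induction n with
  | zero => simpa using one
  | succ n ih => simpa [pow_succ] using ih.mul hF

theorem constantCoeff (hF : ConvergesTo F f) : PowerSeries.constantCoeff F = f 0 := by
  refine HasSum.unique ?_ (hF 0 (by simp))
  simpa using hasSum_single (f := fun n => F.coeff n * (0 : ℂ) ^ n) 0 fun n hn => by
    rw [zero_pow hn, mul_zero]

theorem hasFPowerSeriesAt (hF : ConvergesTo F f) :
    HasFPowerSeriesAt f (FormalMultilinearSeries.ofScalars ℂ fun n => F.coeff n) 0 := by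
  rw [hasFPowerSeriesAt_iff]
  filter_upwards [Metric.ball_mem_nhds (0 : ℂ) one_pos] with q hq
  simpa [FormalMultilinearSeries.coeff_ofScalars, mul_comm] using hF q (by simpa using hq)

theorem unique (hF : ConvergesTo F f) (hG : ConvergesTo G g) (hfg : f =ᶠ[𝓝[≠] 0] g) :
    F = G := by
  have hf := hF.hasFPowerSeriesAt
  have hg := hG.hasFPowerSeriesAt
  have hev : f =ᶠ[𝓝 0] g :=
    (hf.analyticAt.frequently_eq_iff_eventually_eq hg.analyticAt).mp hfg.frequently
  ext n
  simpa [FormalMultilinearSeries.coeff_ofScalars] using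
    congrArg (fun p => p.coeff n) (hf.eq_formalMultilinearSeries (hg.congr hev.symm))

theorem of_hasSum_monomial {ι : Type*} {c : ι → ℂ} {e : ι → ℕ}
    (hF : HasSum (fun i => PowerSeries.monomial (e i) (c i)) F)
    (hf : ∀ q : ℂ, ‖q‖ < 1 → HasSum (fun i => c i * q ^ e i) (f q)) : ConvergesTo F f :=
    fun q hq => by
  refine ((hf q hq).tsum_fiberwise e).congr_fun fun n => ?_
  have hcoeff := (PowerSeries.WithPiTopology.hasSum_iff_hasSum_coeff ℂ).mp hF n
  rw [← hcoeff.tsum_eq, ← tsum_mul_right, tsum_subtype (e ⁻¹' {n}) fun i => c i * q ^ e i]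
  refine tsum_congr fun i => ?_
  by_cases hn : e i = n
  · simp [hn]
  · simp [PowerSeries.coeff_monomial, hn, Ne.symm hn]

end ConvergesTo

theorem summable_monomial {ι K : Type*} [NormedField K] [CompleteSpace K] {c : ι → K} {e : ι → ℕ}
    {x : K} (hx : x ≠ 0) (h : Summable fun i => c i * x ^ e i) :
    Summable fun i => PowerSeries.monomial (e i) (c i) := by
  refine (PowerSeries.WithPiTopology.summable_iff_summable_coeff K).mpr fun n => ?_
  refine ((h.mul_right (x ^ n)⁻¹).indicator (e ⁻¹' {n})).congr fun i => ?_
  by_cases hn : e i = n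
  · simp [hn, hx]
  · simp [PowerSeries.coeff_monomial, hn, Ne.symm hn]

theorem hasSum_mul_zero_pow_of_hasSum_monomial {ι R : Type*} [Semiring R] [TopologicalSpace R]
    {c : ι → R} {e : ι → ℕ} {F : R⟦X⟧} (hF : HasSum (fun i => PowerSeries.monomial (e i) (c i)) F) :
    HasSum (fun i => c i * 0 ^ e i) (PowerSeries.constantCoeff F) := by
  rw [← PowerSeries.coeff_zero_eq_constantCoeff_apply]
  refine ((PowerSeries.WithPiTopology.hasSum_iff_hasSum_coeff R).mp hF 0).congr_fun fun i => ?_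
  simp only [PowerSeries.coeff_monomial, zero_pow_eq, mul_ite, mul_one, mul_zero, eq_comm]

theorem neg_one_pow_mul_pow_sum_eq_prod {R : Type*} [CommRing R] (q : R) (p : ℕ) (s : Finset ℕ) :
    (-1) ^ #s * q ^ ∑ i ∈ s, p * (i + 1) = ∏ i ∈ s, -(q ^ p) ^ (i + 1) := by
  simp_rw [← prod_pow_eq_pow_sum, pow_mul, ← prod_const, ← prod_mul_distrib, neg_one_mul]

theorem hasSum_eulerPhi_pow {R : Type*} [CommRing R] [TopologicalSpace R] [T2Space R] {q : R}
    {p : ℕ} (h : Summable fun s : Finset ℕ => (-1) ^ #s * q ^ ∑ i ∈ s, p * (i + 1)) :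
    HasSum (fun s : Finset ℕ => (-1) ^ #s * q ^ ∑ i ∈ s, p * (i + 1)) (eulerPhi (q ^ p)) := by
  simp_rw [neg_one_pow_mul_pow_sum_eq_prod] at h ⊢
  simpa only [eulerPhi, sub_eq_add_neg, tprod_one_add h] using h.hasSum

theorem summable_neg_one_pow_mul_pow_sum {K : Type*} [NormedField K] [CompleteSpace K] {q : K}
    (hq : ‖q‖ < 1) {p : ℕ} (hp : p ≠ 0) :
    Summable fun s : Finset ℕ => (-1) ^ #s * q ^ ∑ i ∈ s, p * (i + 1) := by
  simp_rw [neg_one_pow_mul_pow_sum_eq_prod]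
  refine summable_finsetProd_of_summable_norm <|
    (summable_norm_mul_pow (norm_pow_lt_one hq hp) (-q ^ p)).congr fun i => ?_
  rw [neg_mul, ← pow_succ']

theorem convergesTo_eulerPhi {p : ℕ} (hp : p ≠ 0) :
    ConvergesTo (eulerPhi ((PowerSeries.X : ℂ⟦X⟧) ^ p)) fun q => eulerPhi (q ^ p) := by
  have hmonomial : ∀ s : Finset ℕ, PowerSeries.monomial (∑ i ∈ s, p * (i + 1)) ((-1 : ℂ) ^ #s) =
      (-1) ^ #s * (PowerSeries.X : ℂ⟦X⟧) ^ ∑ i ∈ s, p * (i + 1) := fun s => by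
    simp [PowerSeries.monomial_eq_C_mul_X_pow]
  have hsum := summable_monomial (x := (1 / 2 : ℂ)) (by norm_num)
    (summable_neg_one_pow_mul_pow_sum (by norm_num) hp)
  refine .of_hasSum_monomial ?_ fun q hq =>
    hasSum_eulerPhi_pow (summable_neg_one_pow_mul_pow_sum hq hp)
  simp_rw [hmonomial] at hsum ⊢
  exact hasSum_eulerPhi_pow hsum

theorem eulerPhi_zero {R : Type*} [CommRing R] [TopologicalSpace R] : eulerPhi (0 : R) = 1 := by
  simp [eulerPhi]

theorem constantCoeff_eulerPhi_X_pow {p : ℕ} (hp : p ≠ 0) :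
    PowerSeries.constantCoeff (eulerPhi ((PowerSeries.X : ℂ⟦X⟧) ^ p)) = 1 := by
  rw [(convergesTo_eulerPhi hp).constantCoeff, zero_pow hp, eulerPhi_zero]

theorem constantCoeff_eulerPhi_X :
    PowerSeries.constantCoeff (eulerPhi (PowerSeries.X : ℂ⟦X⟧)) = 1 := by
  simpa using constantCoeff_eulerPhi_X_pow one_ne_zero

/-! ### The identity of formal power series -/

theorem pow_toNat_secondExponent {G₀ : Type*} [GroupWithZero G₀] {m : ℕ} (hm : 0 < m) (q : G₀)
    (k : Fin (4 * m - 1) → ℤ) : q ^ (secondExponent m k).toNat = q ^ secondExponent m k := by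
  rw [← zpow_natCast, Int.toNat_of_nonneg (secondExponent_nonneg hm k)]

theorem summable_monomial_secondExponent {m : ℕ} (hm : 0 < m) :
    Summable fun k : Fin (4 * m - 1) → ℤ =>
      PowerSeries.monomial (secondExponent m k).toNat (1 : ℂ) := by
  refine summable_monomial (x := (1 / 2 : ℂ)) (by norm_num) ?_
  simpa only [one_mul, pow_toNat_secondExponent hm] using
    (hasSum_zpow_secondExponent (by norm_num) (by norm_num) hm).summable

theorem convergesTo_tsum_secondExponent {m : ℕ} (hm : 0 < m) :
    ConvergesTo (∑' k : Fin (4 * m - 1) → ℤ, PowerSeries.monomial (secondExponent m k).toNat 1)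
      fun q => ∑' k : Fin (4 * m - 1) → ℤ, q ^ secondExponent m k := by
  have hsum := (summable_monomial_secondExponent hm).hasSum
  refine .of_hasSum_monomial hsum fun q hq => ?_
  simp only [← pow_toNat_secondExponent hm, one_mul]
  refine Summable.hasSum ?_
  rcases eq_or_ne q 0 with rfl | hq₀
  · simpa only [one_mul] using (hasSum_mul_zero_pow_of_hasSum_monomial hsum).summable
  · simpa only [pow_toNat_secondExponent hm] using
      (hasSum_zpow_secondExponent hq hq₀ hm).summable

theorem secondProduct_mul_cancel {K : Type*} [NormedField K] [CompleteSpace K] {q : K}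
    (hq : ‖q‖ < 1) (m : ℕ) :
    secondProduct m q * (eulerPhi q ^ 2 * eulerPhi (q ^ 3)) =
      eulerPhi (q ^ (3 * m)) ^ (4 * m) * eulerPhi (q ^ 2) ^ 2 :=
  inv_mul_cancel_right₀ (mul_ne_zero (pow_ne_zero _ (eulerPhi_ne_zero hq))
    (eulerPhi_ne_zero (norm_pow_lt_one hq three_ne_zero))) _

theorem tsum_monomial_secondExponent_mul {m : ℕ} (hm : 0 < m) :
    (∑' k : Fin (4 * m - 1) → ℤ, PowerSeries.monomial (secondExponent m k).toNat (1 : ℂ)) *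
        (eulerPhi PowerSeries.X ^ 2 * eulerPhi (PowerSeries.X ^ 3)) =
      eulerPhi (PowerSeries.X ^ (3 * m)) ^ (4 * m) * eulerPhi (PowerSeries.X ^ 2) ^ 2 := by
  have hone : ConvergesTo (eulerPhi PowerSeries.X) eulerPhi := by
    simpa only [pow_one] using convergesTo_eulerPhi one_ne_zero
  refine ((convergesTo_tsum_secondExponent hm).mul
    ((hone.pow 2).mul (convergesTo_eulerPhi three_ne_zero))).unique
    (((convergesTo_eulerPhi (by omega)).pow (4 * m)).mul
      ((convergesTo_eulerPhi two_ne_zero).pow 2)) ?_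
  filter_upwards [nhdsWithin_le_nhds (Metric.ball_mem_nhds (0 : ℂ) one_pos),
    self_mem_nhdsWithin] with q hq hq₀
  have hq' : ‖q‖ < 1 := by simpa using hq
  rw [(hasSum_zpow_secondExponent hq' hq₀ hm).tsum_eq, secondProduct_mul_cancel hq']

theorem hasSum_X_pow_secondExponent {m : ℕ} (hm : 0 < m) :
    HasSum (fun k : Fin (4 * m - 1) → ℤ =>
        (PowerSeries.X : ℂ⟦X⟧) ^ (secondExponent m k).toNat)
      (secondProduct m (PowerSeries.X : ℂ⟦X⟧)) := by
  have hden : PowerSeries.constantCoeff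
      (eulerPhi (PowerSeries.X : ℂ⟦X⟧) ^ 2 * eulerPhi (PowerSeries.X ^ 3)) ≠ 0 := by
    simp [constantCoeff_eulerPhi_X, constantCoeff_eulerPhi_X_pow]
  have hsum := (summable_monomial_secondExponent hm).hasSum
  rw [(PowerSeries.eq_mul_inv_iff_mul_eq hden).mpr (tsum_monomial_secondExponent_mul hm)] at hsum
  exact hsum.congr_fun fun k => PowerSeries.X_pow_eq _

theorem secondProduct_zero {K : Type*} [Field K] [TopologicalSpace K] {m : ℕ} (hm : 0 < m) :
    secondProduct m (0 : K) = 1 := by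
  rw [secondProduct, zero_pow (by omega), zero_pow two_ne_zero, zero_pow three_ne_zero,
    eulerPhi_zero]
  simp

theorem constantCoeff_secondProduct_X {m : ℕ} (hm : 0 < m) :
    PowerSeries.constantCoeff (secondProduct m (PowerSeries.X : ℂ⟦X⟧)) = 1 := by
  simp [secondProduct, PowerSeries.constantCoeff_inv, constantCoeff_eulerPhi_X,
    constantCoeff_eulerPhi_X_pow, hm.ne']

theorem hasSum_zero_zpow_secondExponent {m : ℕ} (hm : 0 < m) :
    HasSum (fun k : Fin (4 * m - 1) → ℤ => (0 : ℂ) ^ secondExponent m k)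
      (secondProduct m (0 : ℂ)) := by
  have hsum := hasSum_X_pow_secondExponent hm
  simp_rw [PowerSeries.X_pow_eq] at hsum
  have hconst := hasSum_mul_zero_pow_of_hasSum_monomial hsum
  rw [constantCoeff_secondProduct_X hm] at hconst
  rw [secondProduct_zero hm]
  simpa only [one_mul, pow_toNat_secondExponent hm] using hconst

/-! ### The case `m = 1` -/

theorem secondExponent_one (k : Fin (4 * 1 - 1) → ℤ) :
    secondExponent 1 k = firstExponent 1 k := by
  have hcoeff : ∀ i : Fin (4 * 1 - 1), linTildeCoeff 1 (i + 1) = linCoeff 1 (i + 1) := by decide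
  simp only [secondExponent, firstExponent, linTilde, lin, hcoeff]
  norm_num

theorem secondProduct_one_X :
    secondProduct 1 (PowerSeries.X : ℂ⟦X⟧) = firstProduct 1 (PowerSeries.X : ℂ⟦X⟧) := by
  have hphi₃ : PowerSeries.constantCoeff (eulerPhi ((PowerSeries.X : ℂ⟦X⟧) ^ 3)) ≠ 0 := by
    simp [constantCoeff_eulerPhi_X_pow]
  simp only [secondProduct, firstProduct, mul_one, pow_one, Nat.add_one_sub_one,
    PowerSeries.mul_inv_rev, ← sq]
  rw [pow_succ (eulerPhi ((PowerSeries.X : ℂ⟦X⟧) ^ 3)) 3]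
  linear_combination eulerPhi ((PowerSeries.X : ℂ⟦X⟧) ^ 3) ^ 3 * eulerPhi (PowerSeries.X ^ 2) ^ 2 *
    (eulerPhi PowerSeries.X ^ 2)⁻¹ * PowerSeries.mul_inv_cancel _ hphi₃

theorem secondProduct_one {K : Type*} [NormedField K] [CompleteSpace K] {q : K} (hq : ‖q‖ < 1) :
    secondProduct 1 q = firstProduct 1 q := by
  have hphi₁ := eulerPhi_ne_zero hq
  have hphi₃ := eulerPhi_ne_zero (norm_pow_lt_one hq three_ne_zero)
  simp only [secondProduct, firstProduct, mul_one, pow_one, Nat.reduceSub]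
  field_simp

end GaussSeries

theorem mainTheorem2 (m : ℕ) (hm : 0 < m) :
    -- all exponents are nonnegative, so the series is a formal power series in `q`
    (∀ k : Fin (4 * m - 1) → ℤ, 0 ≤ GaussSeries.secondExponent m k) ∧
    -- the identity of formal power series
    HasSum (fun k : Fin (4 * m - 1) → ℤ =>
        (PowerSeries.X : ℂ⟦X⟧) ^ (GaussSeries.secondExponent m k).toNat)
      (GaussSeries.secondProduct m (PowerSeries.X : ℂ⟦X⟧)) ∧
    -- the identity of analytic functions on the open unit disc
    (∀ q : ℂ, ‖q‖ < 1 →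
      HasSum (fun k : Fin (4 * m - 1) → ℤ => q ^ GaussSeries.secondExponent m k)
        (GaussSeries.secondProduct m q)) ∧
    -- for `m = 1` both sides coincide with those of the first class
    (m = 1 →
      (∀ k : Fin (4 * m - 1) → ℤ,
        GaussSeries.secondExponent m k = GaussSeries.firstExponent m k) ∧
      GaussSeries.secondProduct m (PowerSeries.X : ℂ⟦X⟧) =
        GaussSeries.firstProduct m (PowerSeries.X : ℂ⟦X⟧) ∧
      ∀ q : ℂ, ‖q‖ < 1 →
        GaussSeries.secondProduct m q = GaussSeries.firstProduct m q) := by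
  refine ⟨GaussSeries.secondExponent_nonneg hm, GaussSeries.hasSum_X_pow_secondExponent hm,
    fun q hq => ?_, ?_⟩
  · rcases eq_or_ne q 0 with rfl | hq₀
    · exact GaussSeries.hasSum_zero_zpow_secondExponent hm
    · exact GaussSeries.hasSum_zpow_secondExponent hq hq₀ hm
  · rintro rfl
    exact ⟨GaussSeries.secondExponent_one, GaussSeries.secondProduct_one_X,
      fun q hq => GaussSeries.secondProduct_one hq⟩
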